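/- Let $\mathbb F$ be an algebraically closed field of characteristic $0$; all Lie algebras and vector spaces below are finite-dimensional over $\mathbb F$. An invariant metric on a Lie algebra $\mathfrak g$ is a symmetric non-degenerate bilinear form $B$ with $B(x,[y,z])=B([x,y],z)$; the pair $(\mathfrak g,B)$ is then called a quadratic Lie algebra. An isometry of quadratic Lie algebras is a Lie algebra isomorphism that preserves the metrics. Double central extensions. Let $(\mathfrak h,B_{\mathfrak h})$ be a quadratic Lie algebra and $\mathfrak a$ a vector space. Let $\phi$ be a linear map from $\mathfrak a$ to the $B_{\mathfrak h}$-skew-symmetric derivations of $\mathfrak h$, and let $\Psi:\mathfrak a\times\mathfrak a\to\mathfrak h$ and $\omega:\mathfrak a\times\mathfrak a\to\mathfrak a^*$ be skew-symmetric bilinear maps. Put $\Phi(x,y)(a)=B_{\mathfrak h}(\phi(a)x,y)$ and $\chi(a,x)(b)=-B_{\mathfrak h}(\Psi(a,b),x)$, and suppose that for all $a,b,c\in\mathfrak a$ $$[\phi(a),\phi(b)]=\operatorname{ad}_{\mathfrak h}\Psi(a,b),\qquad \phi(a)\Psi(b,c)+\phi(b)\Psi(c,a)+\phi(c)\Psi(a,b)=0,$$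 $$\chi(a,\Psi(b,c))+\chi(b,\Psi(c,a))+\chi(c,\Psi(a,b))=0,\qquad \omega(a,b)(c)=\omega(b,c)(a).$$ The double central extension of $(\mathfrak h,B_{\mathfrak h})$ by $\mathfrak a$ defined by these data is the vector space $\mathfrak a\oplus\mathfrak h\oplus\mathfrak a^*$ with the Lie bracket $$[a,b]=\Psi(a,b)+\omega(a,b),\quad [a,x]=\phi(a)x+\chi(a,x),\quad [x,y]=[x,y]_{\mathfrak h}+\Phi(x,y),\quad \mathfrak a^*\text{ central}$$ ($a,b\in\mathfrak a$, $x,y\in\mathfrak h$), and with the invariant metric $B(a+x+\alpha,b+y+\beta)=B_{\mathfrak h}(x,y)+\beta(a)+\alpha(b)$. Its quotient by $\mathfrak a^*$ is the Lie algebra $\mathfrak a\oplus\mathfrak h$ with bracket $[a,b]=\Psi(a,b)$, $[a,x]=\phi(a)x$, $[x,y]=[x,y]_{\mathfrak h}$. Theorem. Let $(\mathfrak g,B_{\mathfrak g})$ be an $n$-dimensional quadratic Lie algebra, $V$ an $r$-dimensional vector space, and $0\to V\to\mathfrak G\xrightarrow{\ \pi\ }\mathfrak g\to0$ a central extension of $\mathfrak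 g$ by $V$. Suppose that $B_{\mathfrak G}$ is an invariant metric on $\mathfrak G$. (i) If $B_{\mathfrak G}|_{V\times V}$ is non-degenerate, then there is an invariant metric $\bar B_{\mathfrak g}$ on $\mathfrak g$ such that $(\mathfrak G,B_{\mathfrak G})$ is isometric to the orthogonal direct sum $(\mathfrak g,\bar B_{\mathfrak g})\perp(V,B_{\mathfrak G}|_{V\times V})$, where $V$ is an abelian Lie algebra. (ii) If $V$ is isotropic, that is, $B_{\mathfrak G}(V,V)=0$, then $r\le\dim C(\mathfrak g)$, where $C(\mathfrak g)$ is the center of $\mathfrak g$, and there are an $r$-dimensional subspace $\mathfrak a$ and an $(n-r)$-dimensional ideal $\mathfrak h$ of $\mathfrak g$ with $\mathfrak g=\mathfrak a\oplus\mathfrak h$ as vector spaces and $[\mathfrak g,\mathfrak g]\subseteq\mathfrak h$, an invariant metric $B_{\mathfrak h}$ on $\mathfrak h$, and data $(\phi,\Psi,\omega)$ as above, such that: - $(\mathfrak G,B_{\mathfrak G})$ is isometric to the double central extension $\mathfrak a\oplus\mathfrak h\oplus\mathfrak a^*$ of $(\mathfrak h,B_{\mathfrak h})$ by $\mathfrak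 a$ defined by these data, by an isometry $\Omega$ that maps $V$ isomorphically onto $\mathfrak a^*$; - the Lie algebra $\mathfrak a\oplus\mathfrak h$ defined by $\phi$ and $\Psi$ carries an invariant metric $B_{\mathfrak a\oplus\mathfrak h}$ for which $a+x\mapsto a+x$ is an isometry from $\mathfrak a\oplus\mathfrak h$ onto $(\mathfrak g,B_{\mathfrak g})$, and under this identification $\Omega$ followed by the projection onto $\mathfrak a\oplus\mathfrak h$ is $\pi$. -/

import Mathlib

open Module

/-- An invariant metric on a Lie algebra: a symmetric non-degenerate bilinear form `B` with
`B ⁅x, y⁆ z = B x ⁅y, z⁆`. A Lie algebra with such a form is a quadratic Lie algebra. -/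
structure IsInvariantMetric {F L : Type*} [Field F] [LieRing L] [LieAlgebra F L]
    (B : LinearMap.BilinForm F L) : Prop where
  symm : ∀ x y, B x y = B y x
  nondegenerate : B.Nondegenerate
  invariant : ∀ x y z, B x ⁅y, z⁆ = B ⁅x, y⁆ z

/-- The data `(φ, Ψ, ω)` from which a double central extension of the quadratic Lie algebra
`(𝔥, B)` by the vector space `𝔞` is built. The condition `chi_cyclic` is the cyclic condition
`χ(a, Ψ(b, c)) + χ(b, Ψ(c, a)) + χ(c, Ψ(a, b)) = 0`, evaluated at `d`, for the map
`χ(a, x)(d) = -B(Ψ(a, d), x)`. -/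
structure DoubleCentralData (F : Type*) [Field F] (𝔞 : Type*) [AddCommGroup 𝔞] [Module F 𝔞]
    {𝔥 : Type*} [LieRing 𝔥] [LieAlgebra F 𝔥] {B : LinearMap.BilinForm F 𝔥}
    (hB : IsInvariantMetric B) where
  /-- the action of `𝔞` on `𝔥` by derivations -/
  φ : 𝔞 →ₗ[F] LieDerivation F 𝔥 𝔥
  /-- the `𝔥`-component of the bracket of two elements of `𝔞` -/
  Ψ : 𝔞 →ₗ[F] 𝔞 →ₗ[F] 𝔥
  /-- the `𝔞*`-component of the bracket of two elements of `𝔞` -/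
  ω : 𝔞 →ₗ[F] 𝔞 →ₗ[F] Dual F 𝔞
  phi_skew : ∀ a x y, B (φ a x) y = -B x (φ a y)
  psi_alt : ∀ a, Ψ a a = 0
  phi_comm : ∀ a b x, φ a (φ b x) - φ b (φ a x) = ⁅Ψ a b, x⁆
  phi_cyclic : ∀ a b c, φ a (Ψ b c) + φ b (Ψ c a) + φ c (Ψ a b) = 0
  chi_cyclic : ∀ a b c d,
    -B (Ψ a d) (Ψ b c) + -B (Ψ b d) (Ψ c a) + -B (Ψ c d) (Ψ a b) = 0
  omega_alt : ∀ a, ω a a = 0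
  omega_cyclic : ∀ a b c, ω a b c = ω b c a

namespace DoubleCentralData

variable {F : Type*} [Field F] {𝔞 : Type*} [AddCommGroup 𝔞] [Module F 𝔞]
  {𝔥 : Type*} [LieRing 𝔥] [LieAlgebra F 𝔥] {B : LinearMap.BilinForm F 𝔥}
  {hB : IsInvariantMetric B} (D : DoubleCentralData F 𝔞 hB)

/-- `Φ(x, y)(a) = B(φ(a)(x), y)`. -/
def Phi (x y : 𝔥) : Dual F 𝔞 where
  toFun a := B (D.φ a x) y
  map_add' a b := by simp
  map_smul' t a := by simp

/-- `χ(a, x)(b) = -B(Ψ(a, b), x)`. -/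
def chi (a : 𝔞) (x : 𝔥) : Dual F 𝔞 where
  toFun b := -B (D.Ψ a b) x
  map_add' b c := by simp; ring
  map_smul' t b := by simp

@[simp] theorem Phi_apply (x y : 𝔥) (a : 𝔞) : D.Phi x y a = B (D.φ a x) y := rfl

@[simp] theorem chi_apply (a : 𝔞) (x : 𝔥) (b : 𝔞) : D.chi a x b = -B (D.Ψ a b) x := rfl

theorem psi_skew (a b : 𝔞) : D.Ψ a b = -D.Ψ b a := by
  have h := D.psi_alt (a + b)
  simp only [map_add, LinearMap.add_apply, D.psi_alt, zero_add, add_zero] at h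
  exact eq_neg_of_add_eq_zero_right h

/-- The Lie algebra `𝔞 ⊕ 𝔥` with `[a, b] = Ψ(a, b)`, `[a, x] = φ(a)(x)`, `[x, y] = [x, y]_𝔥`. -/
@[ext] structure Base (D : DoubleCentralData F 𝔞 hB) where
  /-- the component in `𝔞` -/
  a : 𝔞
  /-- the component in `𝔥` -/
  x : 𝔥

/-- The double central extension: the Lie algebra `𝔞 ⊕ 𝔥 ⊕ 𝔞*` with
`[a, b] = Ψ(a, b) + ω(a, b)`, `[a, x] = φ(a)(x) + χ(a, x)`, `[x, y] = [x, y]_𝔥 + Φ(x, y)`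
and `𝔞*` central. -/
@[ext] structure Total (D : DoubleCentralData F 𝔞 hB) where
  /-- the component in `𝔞` -/
  a : 𝔞
  /-- the component in `𝔥` -/
  x : 𝔥
  /-- the component in `𝔞*` -/
  α : Dual F 𝔞

namespace Base

variable {D}

/-- The underlying vector space is `𝔞 × 𝔥`. -/
def equivProd : D.Base ≃ 𝔞 × 𝔥 where
  toFun p := (p.a, p.x)
  invFun p := ⟨p.1, p.2⟩

instance : AddCommGroup D.Base := equivProd.addCommGroup
instance : Module F D.Base := equivProd.module F

@[simp] theorem a_zero : (0 : D.Base).a = 0 := rfl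
@[simp] theorem x_zero : (0 : D.Base).x = 0 := rfl
@[simp] theorem a_add (p q : D.Base) : (p + q).a = p.a + q.a := rfl
@[simp] theorem x_add (p q : D.Base) : (p + q).x = p.x + q.x := rfl
@[simp] theorem a_smul (t : F) (p : D.Base) : (t • p).a = t • p.a := rfl
@[simp] theorem x_smul (t : F) (p : D.Base) : (t • p).x = t • p.x := rfl

instance : Bracket D.Base D.Base where
  bracket p q := ⟨0, ⁅p.x, q.x⁆ + D.φ p.a q.x - D.φ q.a p.x + D.Ψ p.a q.a⟩

@[simp] theorem a_lie (p q : D.Base) : ⁅p, q⁆.a = 0 := rfl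
@[simp] theorem x_lie (p q : D.Base) :
    ⁅p, q⁆.x = ⁅p.x, q.x⁆ + D.φ p.a q.x - D.φ q.a p.x + D.Ψ p.a q.a := rfl

end Base

namespace Total

variable {D}

/-- The underlying vector space is `𝔞 × 𝔥 × 𝔞*`. -/
def equivProd : D.Total ≃ 𝔞 × 𝔥 × Dual F 𝔞 where
  toFun p := (p.a, p.x, p.α)
  invFun p := ⟨p.1, p.2.1, p.2.2⟩

instance : AddCommGroup D.Total := equivProd.addCommGroup
instance : Module F D.Total := equivProd.module F

@[simp] theorem a_zero : (0 : D.Total).a = 0 := rfl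
@[simp] theorem x_zero : (0 : D.Total).x = 0 := rfl
@[simp] theorem α_zero : (0 : D.Total).α = 0 := rfl
@[simp] theorem a_add (p q : D.Total) : (p + q).a = p.a + q.a := rfl
@[simp] theorem x_add (p q : D.Total) : (p + q).x = p.x + q.x := rfl
@[simp] theorem α_add (p q : D.Total) : (p + q).α = p.α + q.α := rfl
@[simp] theorem a_smul (t : F) (p : D.Total) : (t • p).a = t • p.a := rfl
@[simp] theorem x_smul (t : F) (p : D.Total) : (t • p).x = t • p.x := rfl
@[simp] theorem α_smul (t : F) (p : D.Total) : (t • p).α = t • p.α := rfl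

instance : Bracket D.Total D.Total where
  bracket p q :=
    ⟨0, ⁅p.x, q.x⁆ + D.φ p.a q.x - D.φ q.a p.x + D.Ψ p.a q.a,
      D.Phi p.x q.x + D.chi p.a q.x - D.chi q.a p.x + D.ω p.a q.a⟩

@[simp] theorem a_lie (p q : D.Total) : ⁅p, q⁆.a = 0 := rfl
@[simp] theorem x_lie (p q : D.Total) :
    ⁅p, q⁆.x = ⁅p.x, q.x⁆ + D.φ p.a q.x - D.φ q.a p.x + D.Ψ p.a q.a := rfl
@[simp] theorem α_lie (p q : D.Total) :
    ⁅p, q⁆.α = D.Phi p.x q.x + D.chi p.a q.x - D.chi q.a p.x + D.ω p.a q.a := rfl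

end Total

/-- The `𝔥`-component of the Jacobi identity. -/
theorem jacobi_x (a b c : 𝔞) (x y z : 𝔥) :
    ⁅x, ⁅y, z⁆ + D.φ b z - D.φ c y + D.Ψ b c⁆ + D.φ a (⁅y, z⁆ + D.φ b z - D.φ c y + D.Ψ b c) =
      (⁅⁅x, y⁆ + D.φ a y - D.φ b x + D.Ψ a b, z⁆ - D.φ c (⁅x, y⁆ + D.φ a y - D.φ b x + D.Ψ a b)) +
      (⁅y, ⁅x, z⁆ + D.φ a z - D.φ c x + D.Ψ a c⁆ +
        D.φ b (⁅x, z⁆ + D.φ a z - D.φ c x + D.Ψ a c)) := by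
  have h1 := D.phi_comm a b z
  have h2 := D.phi_comm a c y
  have h3 := D.phi_comm b c x
  have h4 := D.phi_cyclic a b c
  rw [D.psi_skew c a, map_neg] at h4
  rw [← lie_skew] at h2 h3
  have h5 := leibniz_lie x y z
  have h6 := lie_skew (D.φ c x) y
  simp only [map_add, map_sub, lie_add, lie_sub, add_lie, sub_lie, LieDerivation.apply_lie_eq_add]
  linear_combination (norm := abel) h1 - h2 + h3 + h4 + h5 - h6

/-- The `𝔞*`-component of the Jacobi identity. -/
theorem jacobi_α (a b c : 𝔞) (x y z : 𝔥) :
    D.Phi x (⁅y, z⁆ + D.φ b z - D.φ c y + D.Ψ b c) +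
        D.chi a (⁅y, z⁆ + D.φ b z - D.φ c y + D.Ψ b c) =
      (D.Phi (⁅x, y⁆ + D.φ a y - D.φ b x + D.Ψ a b) z -
        D.chi c (⁅x, y⁆ + D.φ a y - D.φ b x + D.Ψ a b)) +
      (D.Phi y (⁅x, z⁆ + D.φ a z - D.φ c x + D.Ψ a c) +
        D.chi b (⁅x, z⁆ + D.φ a z - D.φ c x + D.Ψ a c)) := by
  ext d
  have key (u : 𝔞) (s t : 𝔥) : B (D.Ψ u d) ⁅s, t⁆ = B (D.φ u s) (D.φ d t) -
      B (D.φ d s) (D.φ u t) := by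
    rw [hB.invariant, ← D.phi_comm, map_sub, LinearMap.sub_apply, D.phi_skew u (D.φ d s),
      D.phi_skew d (D.φ u s)]
    ring
  have cyc (u v : 𝔞) (s : 𝔥) : B (D.φ d s) (D.Ψ u v) =
      B (D.Ψ u d) (D.φ v s) - B (D.Ψ v d) (D.φ u s) := by
    have h := D.phi_cyclic u v d
    rw [D.psi_skew d u, map_neg] at h
    have h' := congrArg (fun w => B w s) h
    simp only [map_add, map_neg, LinearMap.add_apply, LinearMap.neg_apply, D.phi_skew,
      map_zero, LinearMap.zero_apply] at h'
    rw [hB.symm (D.φ d s)]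
    linear_combination -h'
  have coc : B (D.φ d x) ⁅y, z⁆ = B (D.φ d ⁅x, y⁆) z + B (D.φ d y) ⁅x, z⁆ := by
    rw [LieDerivation.apply_lie_eq_add, map_add, LinearMap.add_apply, hB.invariant, hB.invariant,
      ← lie_skew x, map_neg, LinearMap.neg_apply]
    ring
  have h := D.chi_cyclic a b c d
  rw [D.psi_skew c a, map_neg] at h
  simp only [LinearMap.add_apply, LinearMap.sub_apply, Phi_apply, chi_apply, map_add, map_sub]
  rw [key, key, key, coc, D.phi_skew d (D.φ a y), D.phi_skew d (D.φ b x), D.phi_skew d (D.Ψ a b),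
    hB.symm (D.Ψ a b) (D.φ d z), cyc, cyc, cyc]
  rw [hB.symm (D.φ c x) (D.φ d y)]
  linear_combination h

namespace Base

variable {D}

instance : LieRing D.Base where
  add_lie p q r := by ext <;> simp; abel
  lie_add p q r := by ext <;> simp; abel
  lie_self p := by ext <;> simp [D.psi_alt]
  leibniz_lie p q r := by
    ext
    · simp
    · simpa using! D.jacobi_x p.a q.a r.a p.x q.x r.x

instance : LieAlgebra F D.Base where
  lie_smul t p q := by ext <;> simp [smul_add, smul_sub]

end Base

theorem Phi_add_left (x y z : 𝔥) : D.Phi (x + y) z = D.Phi x z + D.Phi y z := by ext; simp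

theorem Phi_add_right (x y z : 𝔥) : D.Phi x (y + z) = D.Phi x y + D.Phi x z := by ext; simp

theorem chi_add_left (a b : 𝔞) (x : 𝔥) : D.chi (a + b) x = D.chi a x + D.chi b x := by
  ext; simp; ring

theorem chi_add_right (a : 𝔞) (x y : 𝔥) : D.chi a (x + y) = D.chi a x + D.chi a y := by
  ext; simp; ring

theorem chi_zero_left (x : 𝔥) : D.chi 0 x = 0 := by ext; simp

namespace Total

variable {D} [CharZero F]

instance : LieRing D.Total where
  add_lie p q r := by
    ext1
    · simp
    · simp; abel
    · simp [Phi_add_left, chi_add_left, chi_add_right]; abel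
  lie_add p q r := by
    ext1
    · simp
    · simp; abel
    · simp [Phi_add_right, chi_add_left, chi_add_right]; abel
  lie_self p := by
    ext1
    · simp
    · simp [D.psi_alt]
    · ext d
      have h := D.phi_skew d p.x p.x
      rw [hB.symm p.x] at h
      simpa [D.omega_alt, self_eq_neg] using h
  leibniz_lie p q r := by
    ext1
    · simp
    · simpa using! D.jacobi_x p.a q.a r.a p.x q.x r.x
    · simpa [chi_zero_left] using! D.jacobi_α p.a q.a r.a p.x q.x r.x

instance : LieAlgebra F D.Total where
  lie_smul t p q := by
    ext1
    · simp
    · simp [smul_add, smul_sub]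
    · ext; simp; ring

/-- The projection of `𝔞 ⊕ 𝔥 ⊕ 𝔞*` onto `𝔞 ⊕ 𝔥`, a Lie algebra homomorphism. -/
def proj : D.Total →ₗ⁅F⁆ D.Base where
  toFun p := ⟨p.a, p.x⟩
  map_add' _ _ := rfl
  map_smul' _ _ := rfl
  map_lie' := rfl

/-- `B(a + x + α, b + y + β) = B_𝔥(x, y) + β(a) + α(b)`. -/
def metric : LinearMap.BilinForm F D.Total :=
  LinearMap.mk₂ F (fun p q => B p.x q.x + q.α p.a + p.α q.a)
    (fun p p' q => by simp; ring) (fun t p q => by simp; ring)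
    (fun p q q' => by simp; ring) (fun t p q => by simp; ring)

end Total

end DoubleCentralData

/-! ### Invariant metrics, and the orthogonal splitting when `V` is non-degenerate -/

section Nondegenerate

variable {F 𝔤 V 𝔊 : Type*} [Field F]
  [LieRing 𝔤] [LieAlgebra F 𝔤] [LieRing V] [LieAlgebra F V] [LieRing 𝔊] [LieAlgebra F 𝔊]

/-! Since `V` is central, invariance makes it orthogonal to every bracket of `𝔊`. Both cases rest on
this.

If `V` is non-degenerate, orthogonal projection onto `V` kills brackets. Paired with `π` it gives a
Lie isomorphism from `𝔊` onto `𝔤 × V`, and `𝔤` inherits the metric of the orthogonal complement of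
`V`.

If `V` is isotropic, it lies in its own complement `V^⊥`, which also contains all brackets. The
ideal `𝔥 = π(V^⊥) = V^⊥/V` therefore contains `[𝔤, 𝔤]` and inherits a metric from `𝔊`. For a linear
complement `𝔞` of `𝔥`, the metric pairs `V` perfectly with `𝔞`, so `V ≅ 𝔞*` (`pairing_bijective`). A
section `s` of `π` can be corrected by vectors of `V` until `s 𝔞` is isotropic and orthogonal to `s
𝔥` (`exists_isotropic_section`). In the coordinates `𝔊 = s 𝔞 ⊕ s 𝔥 ⊕ V` the metric is the standard
one, and the `𝔞*`-coordinate of `X` is the functional `BG X (s ·)`. The data are then forced: `φ`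
and `Ψ` are brackets of `𝔤`, `ω` is `BG ⁅s a, s b⁆ (s c)`, and their identities are Jacobi and
invariance (`form_lie_section`, `metric_totalHom`). -/

theorem IsInvariantMetric.eq_zero {B : LinearMap.BilinForm F 𝔤} (hB : IsInvariantMetric B)
    {x : 𝔤} (h : ∀ y, B x y = 0) : x = 0 :=
  hB.nondegenerate.1 x h

theorem IsInvariantMetric.of_separating {B : LinearMap.BilinForm F 𝔤}
    (symm : ∀ x y, B x y = B y x) (sep : ∀ x, (∀ y, B x y = 0) → x = 0)
    (inv : ∀ x y z, B x ⁅y, z⁆ = B ⁅x, y⁆ z) : IsInvariantMetric B :=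
  ⟨symm, ⟨sep, fun y hy => sep y fun x => (symm y x).trans (hy x)⟩, inv⟩

theorem IsInvariantMetric.comp_equiv {B : LinearMap.BilinForm F 𝔤} (hB : IsInvariantMetric B)
    (e : 𝔊 ≃ₗ⁅F⁆ 𝔤) :
    IsInvariantMetric (B.comp (e : 𝔊 →ₗ[F] 𝔤) (e : 𝔊 →ₗ[F] 𝔤)) := by
  refine .of_separating (fun x y => hB.symm _ _) (fun x hx => ?_) (fun x y z => ?_)
  · refine (map_eq_zero_iff e e.injective).1 (hB.eq_zero fun y => ?_)
    obtain ⟨y, rfl⟩ := e.surjective y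
    exact hx y
  · have h := hB.invariant (e x) (e y) (e z)
    rw [← LieEquiv.map_lie, ← LieEquiv.map_lie] at h
    exact h

/-- A central ideal on which the metric is non-degenerate splits off as an orthogonal direct
summand. -/
theorem exists_isometry_prod_of_nondegenerate [IsLieAbelian V] [FiniteDimensional F V]
    {ι : V →ₗ⁅F⁆ 𝔊} {π : 𝔊 →ₗ⁅F⁆ 𝔤} (hπ : Function.Surjective π) (hexact : Function.Exact ι π)
    (hcentral : ∀ (v : V) (X : 𝔊), ⁅ι v, X⁆ = 0)
    {BG : LinearMap.BilinForm F 𝔊} (hBG : IsInvariantMetric BG)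
    (hV : (BG.comp (ι : V →ₗ[F] 𝔊) (ι : V →ₗ[F] 𝔊)).Nondegenerate) :
    ∃ Bg' : LinearMap.BilinForm F 𝔤, IsInvariantMetric Bg' ∧
      ∃ ψ : 𝔊 ≃ₗ⁅F⁆ 𝔤 × V, ∀ X Y : 𝔊,
        BG X Y = Bg' (ψ X).1 (ψ Y).1 + BG (ι (ψ X).2) (ι (ψ Y).2) := by
  -- Orthogonal projection onto `V`: `ρ X` represents the functional `u ↦ BG X (ι u)` through the
  -- non-degenerate form on `V`.
  let ρ : 𝔊 →ₗ[F] V :=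
    (LinearMap.BilinForm.toDual _ hV).symm.toLinearMap ∘ₗ BG.compl₂ (ι : V →ₗ[F] 𝔊)
  have hρ (X : 𝔊) (u : V) : BG (ι (ρ X)) (ι u) = BG X (ι u) :=
    LinearMap.BilinForm.apply_toDual_symm_apply (hB := hV) (BG.compl₂ (ι : V →ₗ[F] 𝔊) X) u
  have ρ_eq (X : 𝔊) (w : V) (h : ∀ u, BG X (ι u) = BG (ι w) (ι u)) : ρ X = w := by
    refine sub_eq_zero.1 (hV.1 _ fun u => ?_)
    have : BG (ι (ρ X)) (ι u) - BG (ι w) (ι u) = 0 := by rw [hρ, h, sub_self]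
    simpa using this
  have hρι (v : V) : ρ (ι v) = v := ρ_eq _ _ fun _ => rfl
  have hρlie (X Y : 𝔊) : ρ ⁅X, Y⁆ = 0 := ρ_eq _ _ fun u => by
    rw [hBG.symm, hBG.invariant, hcentral]; simp
  have hπι (v : V) : π (ι v) = 0 := hexact.apply_apply_eq_zero v
  let ψ₀ : 𝔊 →ₗ⁅F⁆ 𝔤 × V :=
    { (π : 𝔊 →ₗ[F] 𝔤).prod ρ with
      map_lie' := fun {X Y} => by
        refine Prod.ext ?_ ?_
        · exact π.map_lie X Y
        · exact (hρlie X Y).trans (trivial_lie_zero V V (ρ X) (ρ Y)).symm }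
  have hψ₀ (X : 𝔊) : ψ₀ X = (π X, ρ X) := rfl
  have inj : Function.Injective ψ₀ := by
    refine (injective_iff_map_eq_zero ψ₀).2 fun X hX => ?_
    obtain ⟨h1, h2⟩ := Prod.ext_iff.1 ((hψ₀ X).symm.trans hX)
    obtain ⟨v, rfl⟩ := (hexact X).1 h1
    simp only [hρι] at h2
    simp [h2]
  have surj : Function.Surjective ψ₀ := by
    rintro ⟨p, w⟩
    obtain ⟨X, rfl⟩ := hπ p
    refine ⟨X - ι (ρ X) + ι w, ?_⟩
    rw [hψ₀]
    simp [hπι, hρι]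
  let ψ : 𝔊 ≃ₗ⁅F⁆ 𝔤 × V := LieEquiv.ofBijective ψ₀ ⟨inj, surj⟩
  -- A Lie section of `π` whose image is the orthogonal complement of `V`.
  let σ : 𝔤 →ₗ⁅F⁆ 𝔊 := (ψ.symm : 𝔤 × V →ₗ⁅F⁆ 𝔊).comp (LieHom.inl F 𝔤 V)
  have hψσ (p : 𝔤) : ψ₀ (σ p) = (p, 0) := ψ.apply_symm_apply (p, 0)
  have hσ (X : 𝔊) : X = σ (π X) + ι (ρ X) := by
    apply inj
    rw [map_add, hψσ, hψ₀, hψ₀, hπι, hρι]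
    simp
  have hσι (p : 𝔤) (v : V) : BG (σ p) (ι v) = 0 := by
    have h : ρ (σ p) = 0 := congrArg Prod.snd (hψσ p)
    rw [← hρ, h]; simp
  have key (X Y : 𝔊) : BG X Y = BG (σ (π X)) (σ (π Y)) + BG (ι (ρ X)) (ι (ρ Y)) := by
    conv_lhs => rw [hσ X, hσ Y]
    simp only [map_add, LinearMap.add_apply, hσι, hBG.symm (ι _) (σ _)]
    ring
  refine ⟨BG.comp (σ : 𝔤 →ₗ[F] 𝔊) (σ : 𝔤 →ₗ[F] 𝔊),
    .of_separating (fun x y => hBG.symm _ _) (fun p hp => ?_) (fun x y z => ?_), ψ, key⟩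
  -- `σ p` is always orthogonal to `ι V`, so orthogonality to the image of `σ` puts it in the
  -- radical of `BG`.
  · have h0 : σ p = 0 := hBG.eq_zero fun Y => by
      have h : BG (σ p) (σ (π Y)) = 0 := hp (π Y)
      rw [hσ Y, map_add, hσι, h, add_zero]
    have := hψσ p
    rw [h0, map_zero] at this
    exact (congrArg Prod.fst this).symm
  · have h := hBG.invariant (σ x) (σ y) (σ z)
    rw [← LieHom.map_lie, ← LieHom.map_lie] at h
    exact h

end Nondegenerate

/-- `ι` and `π` present `𝔊` as a central extension of `𝔤` by an isotropic subspace, for the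
invariant metric `BG` on `𝔊`. -/
structure IsIsotropicCentralExtension {F 𝔤 V 𝔊 : Type*} [Field F]
    [LieRing 𝔤] [LieAlgebra F 𝔤] [AddCommGroup V] [Module F V] [LieRing 𝔊] [LieAlgebra F 𝔊]
    (ι : V →ₗ[F] 𝔊) (π : 𝔊 →ₗ⁅F⁆ 𝔤) (BG : LinearMap.BilinForm F 𝔊) : Prop where
  metric : IsInvariantMetric BG
  injective : Function.Injective ι
  surjective : Function.Surjective π
  exact : Function.Exact ι π
  central : ∀ (v : V) (X : 𝔊), ⁅ι v, X⁆ = 0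
  isotropic : ∀ u v, BG (ι u) (ι v) = 0

/-! ### Isotropic `V`: the ideal `V^⊥/V`, the duality with a complement, isotropic sections -/

namespace IsIsotropicCentralExtension

variable {F 𝔤 V 𝔊 : Type*} [Field F]
  [LieRing 𝔤] [LieAlgebra F 𝔤] [AddCommGroup V] [Module F V] [LieRing 𝔊] [LieAlgebra F 𝔊]
  {ι : V →ₗ[F] 𝔊} {π : 𝔊 →ₗ⁅F⁆ 𝔤} {BG : LinearMap.BilinForm F 𝔊}

theorem exists_eq_add (h : IsIsotropicCentralExtension ι π BG) {X Y : 𝔊} (hXY : π X = π Y) :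
    ∃ v, X = Y + ι v := by
  obtain ⟨v, hv⟩ := (h.exact (X - Y)).1 (by rw [map_sub, hXY, sub_self])
  exact ⟨v, by rw [hv]; abel⟩

theorem form_lie (h : IsIsotropicCentralExtension ι π BG) (v : V) (X Y : 𝔊) :
    BG (ι v) ⁅X, Y⁆ = 0 := by
  rw [h.metric.invariant, h.central]; simp

/-- The kernel of `π` is the central subspace `ι V`. Brackets in `𝔊` can thus be computed on any
linear section. -/
theorem lie_congr (h : IsIsotropicCentralExtension ι π BG) {X X' Y Y' : 𝔊} (hX : π X = π X')
    (hY : π Y = π Y') : ⁅X, Y⁆ = ⁅X', Y'⁆ := by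
  obtain ⟨v, rfl⟩ := h.exists_eq_add hX
  obtain ⟨w, rfl⟩ := h.exists_eq_add hY
  have hw : ⁅X', ι w⁆ = 0 := by rw [← lie_skew, h.central, neg_zero]
  simp [h.central, hw]

theorem form_congr (h : IsIsotropicCentralExtension ι π BG) (v : V) {X Y : 𝔊}
    (hXY : π X = π Y) : BG (ι v) X = BG (ι v) Y := by
  obtain ⟨w, rfl⟩ := h.exists_eq_add hXY
  simp [h.isotropic]

/-- The image in `𝔤` of the orthogonal complement of `V`. -/
def orthogonalIdeal (h : IsIsotropicCentralExtension ι π BG) : LieIdeal F 𝔤 where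
  carrier := {p | ∃ X, (∀ v, BG (ι v) X = 0) ∧ π X = p}
  zero_mem' := ⟨0, by simp, by simp⟩
  add_mem' := by
    rintro _ _ ⟨X, hX, rfl⟩ ⟨Y, hY, rfl⟩
    exact ⟨X + Y, by simp [hX, hY], by simp⟩
  smul_mem' := by
    rintro t _ ⟨X, hX, rfl⟩
    exact ⟨t • X, by simp [hX], by simp⟩
  lie_mem := by
    rintro q _ ⟨X, hX, rfl⟩
    obtain ⟨Y, rfl⟩ := h.surjective q
    exact ⟨⁅Y, X⁆, fun v => h.form_lie v Y X, by simp⟩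

theorem apply_mem_orthogonalIdeal (h : IsIsotropicCentralExtension ι π BG) {X : 𝔊} :
    π X ∈ h.orthogonalIdeal ↔ ∀ v, BG (ι v) X = 0 := by
  refine ⟨?_, fun hX => ⟨X, hX, rfl⟩⟩
  rintro ⟨Y, hY, hYX⟩ v
  rw [h.form_congr v hYX.symm, hY]

theorem lie_mem_orthogonalIdeal (h : IsIsotropicCentralExtension ι π BG) (p q : 𝔤) :
    ⁅p, q⁆ ∈ h.orthogonalIdeal := by
  obtain ⟨X, rfl⟩ := h.surjective p
  obtain ⟨Y, rfl⟩ := h.surjective q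
  rw [← LieHom.map_lie]
  exact h.apply_mem_orthogonalIdeal.2 fun v => h.form_lie v X Y

/-- Isotropy lets the pairing with `V` factor through `𝔤`, and non-degeneracy of `BG` then embeds
`V` in the dual of `𝔤`. The ideal is the common kernel of the functionals so obtained. -/
theorem finrank_orthogonalIdeal (h : IsIsotropicCentralExtension ι π BG)
    [FiniteDimensional F 𝔤] [FiniteDimensional F V] :
    finrank F h.orthogonalIdeal + finrank F V = finrank F 𝔤 := by
  obtain ⟨s, hs⟩ := (π : 𝔊 →ₗ[F] 𝔤).exists_rightInverse_of_surjective
    (LinearMap.range_eq_top.2 h.surjective)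
  replace hs (p : 𝔤) : π (s p) = p := LinearMap.congr_fun hs p
  let κ : V →ₗ[F] Dual F 𝔤 := BG.compl₁₂ ι s
  have hκ (v : V) (p : 𝔤) : κ v p = BG (ι v) (s p) := rfl
  have inj : Function.Injective κ := by
    refine (injective_iff_map_eq_zero κ).2 fun v hv => h.injective ?_
    rw [map_zero]
    refine h.metric.eq_zero fun X => ?_
    rw [h.form_congr v (hs (π X)).symm, ← hκ, hv, LinearMap.zero_apply]
  have hI : h.orthogonalIdeal.toSubmodule = (LinearMap.range κ).dualCoannihilator := by
    ext p
    rw [Submodule.mem_dualCoannihilator, LieSubmodule.mem_toSubmodule]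
    conv_lhs => rw [← hs p, h.apply_mem_orthogonalIdeal]
    constructor
    · rintro hp _ ⟨v, rfl⟩
      exact hp v
    · exact fun hp v => hp _ ⟨v, rfl⟩
  have := Subspace.finrank_add_finrank_dualCoannihilator_eq (LinearMap.range κ)
  rw [LinearMap.finrank_range_of_inj inj, ← hI] at this
  rw [add_comm]
  exact this

/-- Two vectors orthogonal to `V` pair as their images in `𝔤` do. -/
theorem form_congr_of_mem (h : IsIsotropicCentralExtension ι π BG) {X X' Y Y' : 𝔊}
    (hX : π X ∈ h.orthogonalIdeal) (hY : π Y ∈ h.orthogonalIdeal)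
    (hXX' : π X = π X') (hYY' : π Y = π Y') : BG X Y = BG X' Y' := by
  rw [hXX'] at hX
  rw [h.apply_mem_orthogonalIdeal] at hX hY
  obtain ⟨v, rfl⟩ := h.exists_eq_add hXX'
  obtain ⟨w, hw⟩ := h.exists_eq_add hYY'
  rw [map_add, LinearMap.add_apply, hY, add_zero, hw, map_add, h.metric.symm X' (ι w), hX,
    add_zero]

/-- The pairing of `V` with a lift of a complement of the ideal `orthogonalIdeal`. -/
def pairing (BG : LinearMap.BilinForm F 𝔊) (ι : V →ₗ[F] 𝔊) (s : 𝔤 →ₗ[F] 𝔊)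
    (𝔞 : Submodule F 𝔤) : V →ₗ[F] Dual F 𝔞 :=
  BG.compl₁₂ ι (s ∘ₗ 𝔞.subtype)

/-- A vector of `V` is already orthogonal to lifts of the ideal; if it also kills `s 𝔞`, it is
orthogonal to all of `𝔊`. Surjectivity is a dimension count. -/
theorem pairing_bijective (h : IsIsotropicCentralExtension ι π BG)
    [FiniteDimensional F 𝔤] [FiniteDimensional F V] {s : 𝔤 →ₗ[F] 𝔊} (hs : ∀ p, π (s p) = p)
    {𝔞 : Submodule F 𝔤} (h𝔞 : IsCompl 𝔞 h.orthogonalIdeal.toSubmodule) :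
    Function.Bijective (pairing BG ι s 𝔞) := by
  have inj : Function.Injective (pairing BG ι s 𝔞) := by
    refine (injective_iff_map_eq_zero _).2 fun v hv => h.injective ?_
    rw [map_zero]
    refine h.metric.eq_zero fun X => ?_
    obtain ⟨a, ha, x, hx, hax⟩ := Submodule.mem_sup.1
      (h𝔞.sup_eq_top ▸ Submodule.mem_top : π X ∈ 𝔞 ⊔ h.orthogonalIdeal.toSubmodule)
    have h1 : BG (ι v) (s a) = 0 := LinearMap.congr_fun hv ⟨a, ha⟩
    have h2 : BG (ι v) (s x) = 0 := by
      refine h.apply_mem_orthogonalIdeal.1 ?_ v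
      rwa [hs]
    rw [h.form_congr v (hs (π X)).symm, ← hax, map_add, map_add, h1, h2, add_zero]
  refine ⟨inj, (LinearMap.injective_iff_surjective_of_finrank_eq_finrank ?_).1 inj⟩
  have h1 := Submodule.finrank_add_eq_of_isCompl h𝔞
  have h2 : finrank F h.orthogonalIdeal.toSubmodule + finrank F V = _ := h.finrank_orthogonalIdeal
  rw [Subspace.dual_finrank_eq]
  omega

/-- A linear section of `π` for which the lift of `𝔞` is isotropic and orthogonal to the lift of
`orthogonalIdeal`. -/
theorem exists_isotropic_section [CharZero F] (h : IsIsotropicCentralExtension ι π BG)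
    [FiniteDimensional F 𝔤] [FiniteDimensional F V]
    {𝔞 : Submodule F 𝔤} (h𝔞 : IsCompl 𝔞 h.orthogonalIdeal.toSubmodule) :
    ∃ s : 𝔤 →ₗ[F] 𝔊, (∀ p, π (s p) = p) ∧ ∀ a ∈ 𝔞,
      (∀ b ∈ 𝔞, BG (s a) (s b) = 0) ∧ ∀ x ∈ h.orthogonalIdeal, BG (s a) (s x) = 0 := by
  obtain ⟨s, hs⟩ := (π : 𝔊 →ₗ[F] 𝔤).exists_rightInverse_of_surjective
    (LinearMap.range_eq_top.2 h.surjective)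
  replace hs (p : 𝔤) : π (s p) = p := LinearMap.congr_fun hs p
  let ξ := LinearEquiv.ofBijective _ (h.pairing_bijective hs h𝔞)
  let P := 𝔞.projection _ h𝔞
  have hPa (a) (ha : a ∈ 𝔞) : P a = a := Submodule.projection_apply_of_mem_left h𝔞 ha
  have hPx (x) (hx : x ∈ h.orthogonalIdeal) : P x = 0 :=
    (Submodule.projection_apply_eq_zero_iff h𝔞).2 hx
  -- The correction `t` is chosen so that `ι (t p)` pairs with `s a` as `s (P p / 2 - p)` does. On
  -- `𝔞` this is `-1/2` of the old pairing, because both arguments get corrected. On the ideal it is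
  -- the full negative, because only the correction of `s x` meets `s a`: `V` is orthogonal to the
  -- lift of the ideal.
  let τ : 𝔤 →ₗ[F] Dual F 𝔞 :=
    BG.compl₁₂ (s ∘ₗ ((2⁻¹ : F) • P - LinearMap.id)) (s ∘ₗ 𝔞.subtype)
  let t : 𝔤 →ₗ[F] V := ξ.symm.toLinearMap ∘ₗ τ
  have ht (p : 𝔤) (a) (ha : a ∈ 𝔞) : BG (ι (t p)) (s a) = BG (s ((2⁻¹ : F) • P p - p)) (s a) :=
    LinearMap.congr_fun (ξ.apply_symm_apply (τ p)) ⟨a, ha⟩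
  have htx (p : 𝔤) (x) (hx : x ∈ h.orthogonalIdeal) : BG (ι (t p)) (s x) = 0 := by
    refine h.apply_mem_orthogonalIdeal.1 ?_ _
    rwa [hs]
  refine ⟨s + ι ∘ₗ t, fun p => ?_, fun a ha => ⟨fun b hb => ?_, fun x hx => ?_⟩⟩
  · simp [hs, h.exact.apply_apply_eq_zero]
  · simp only [LinearMap.add_apply, LinearMap.comp_apply, map_add, h.isotropic,
      h.metric.symm (s a) (ι _), ht _ a ha, ht _ b hb, hPa a ha, hPa b hb, map_sub, map_smul,
      LinearMap.sub_apply, LinearMap.smul_apply, smul_eq_mul, h.metric.symm (s b) (s a)]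
    ring
  · simp only [LinearMap.add_apply, LinearMap.comp_apply, map_add, h.isotropic,
      h.metric.symm (s a) (ι _), ht _ a ha, htx _ x hx, hPx x hx, map_sub, smul_zero, map_zero,
      LinearMap.sub_apply, LinearMap.zero_apply, h.metric.symm (s x) (s a)]
    ring

/-- All brackets lie in `orthogonalIdeal`, so by invariance its complement for `Bg` is central; that
complement has the dimension of `V`. -/
theorem finrank_le_finrank_center (h : IsIsotropicCentralExtension ι π BG)
    [FiniteDimensional F 𝔤] [FiniteDimensional F V]
    {Bg : LinearMap.BilinForm F 𝔤} (hBg : IsInvariantMetric Bg) :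
    finrank F V ≤ finrank F (LieAlgebra.center F 𝔤) := by
  have h1 : Bg.orthogonal h.orthogonalIdeal.toSubmodule ≤
      (LieAlgebra.center F 𝔤).toSubmodule := by
    intro z hz
    rw [LieSubmodule.mem_toSubmodule, LieModule.mem_maxTrivSubmodule]
    refine fun x => hBg.eq_zero fun y => ?_
    rw [hBg.symm, hBg.invariant]
    exact hz _ (h.lie_mem_orthogonalIdeal y x)
  have h2 := Submodule.finrank_mono h1
  rw [LinearMap.BilinForm.finrank_orthogonal hBg.nondegenerate] at h2
  have h3 : finrank F h.orthogonalIdeal.toSubmodule + finrank F V = _ := h.finrank_orthogonalIdeal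
  have h4 : finrank F V ≤ finrank F (LieAlgebra.center F 𝔤).toSubmodule := by omega
  exact h4

end IsIsotropicCentralExtension

/-! ### The double central extension data attached to an isotropic section -/

namespace IsIsotropicCentralExtension

variable {F 𝔤 V 𝔊 : Type*} [Field F]
  [LieRing 𝔤] [LieAlgebra F 𝔤] [AddCommGroup V] [Module F V] [LieRing 𝔊] [LieAlgebra F 𝔊]
  {ι : V →ₗ[F] 𝔊} {π : 𝔊 →ₗ⁅F⁆ 𝔤} {BG : LinearMap.BilinForm F 𝔊}

/-- The form on `orthogonalIdeal` pulled back along a section `s` of `π`. -/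
def idealForm (h : IsIsotropicCentralExtension ι π BG) (s : 𝔤 →ₗ[F] 𝔊) :
    LinearMap.BilinForm F h.orthogonalIdeal :=
  BG.comp (s ∘ₗ h.orthogonalIdeal.toSubmodule.subtype)
    (s ∘ₗ h.orthogonalIdeal.toSubmodule.subtype)

theorem idealForm_apply (h : IsIsotropicCentralExtension ι π BG) (s : 𝔤 →ₗ[F] 𝔊)
    (x y : h.orthogonalIdeal) : h.idealForm s x y = BG (s x) (s y) := rfl

/-- The section `s` need not respect brackets, but `⁅s p, s q⁆` is still a lift of `⁅p, q⁆`. Freedom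
in the lifts thus transfers invariance from `𝔊` to the ideal. -/
theorem idealForm_eq (h : IsIsotropicCentralExtension ι π BG) {s : 𝔤 →ₗ[F] 𝔊}
    (hs : ∀ p, π (s p) = p) {x y : h.orthogonalIdeal} {X Y : 𝔊} (hX : π X = x) (hY : π Y = y) :
    h.idealForm s x y = BG X Y :=
  h.form_congr_of_mem (X := s x) (Y := s y) (by simp [hs]) (by simp [hs]) (by simp [hs, hX])
    (by simp [hs, hY])

/-- The bracket of `𝔤`, with values in `orthogonalIdeal`. -/
def lieBracket (h : IsIsotropicCentralExtension ι π BG) :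
    𝔤 →ₗ[F] 𝔤 →ₗ[F] h.orthogonalIdeal :=
  LinearMap.mk₂ F (fun p q => ⟨⁅p, q⁆, h.lie_mem_orthogonalIdeal p q⟩)
    (fun _ _ _ => Subtype.ext (by simp)) (fun _ _ _ => Subtype.ext (by simp))
    (fun _ _ _ => Subtype.ext (by simp)) (fun _ _ _ => Subtype.ext (by simp))

@[simp] theorem coe_lieBracket
    (h : IsIsotropicCentralExtension ι π BG) (p q : 𝔤) :
    (h.lieBracket p q : 𝔤) = ⁅p, q⁆ := rfl

/-- An element of `𝔤` acts on `orthogonalIdeal` by a derivation. -/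
def action (h : IsIsotropicCentralExtension ι π BG) :
    𝔤 →ₗ[F] LieDerivation F h.orthogonalIdeal h.orthogonalIdeal where
  toFun p :=
    { toLinearMap := h.lieBracket p ∘ₗ h.orthogonalIdeal.toSubmodule.subtype
      leibniz' := fun x y => Subtype.ext (by
        have h1 := leibniz_lie p (x : 𝔤) (y : 𝔤)
        have h2 := lie_skew (y : 𝔤) ⁅p, (x : 𝔤)⁆
        change ⁅p, ⁅(x : 𝔤), (y : 𝔤)⁆⁆ = ⁅(x : 𝔤), ⁅p, (y : 𝔤)⁆⁆ - ⁅(y : 𝔤), ⁅p, (x : 𝔤)⁆⁆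
        rw [h1, ← h2]; abel) }
  map_add' p q := LieDerivation.ext fun x => Subtype.ext (add_lie p q (x : 𝔤))
  map_smul' t p := LieDerivation.ext fun x => Subtype.ext (smul_lie t p (x : 𝔤))

@[simp] theorem coe_action
    (h : IsIsotropicCentralExtension ι π BG) (p : 𝔤) (x : h.orthogonalIdeal) :
    (h.action p x : 𝔤) = ⁅p, (x : 𝔤)⁆ := rfl

/-- The trilinear form `BG ⁅s a, s b⁆ (s c)` on `𝔞`. -/
def cocycle (BG : LinearMap.BilinForm F 𝔊)
    (𝔞 : Submodule F 𝔤) (s : 𝔤 →ₗ[F] 𝔊) : 𝔞 →ₗ[F] 𝔞 →ₗ[F] Dual F 𝔞 :=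
  LinearMap.mk₂ F (fun a b => BG ⁅s a, s b⁆ ∘ₗ s ∘ₗ 𝔞.subtype)
    (fun _ _ _ => by ext; simp) (fun _ _ _ => by ext; simp)
    (fun _ _ _ => by ext; simp) (fun _ _ _ => by ext; simp)

@[simp] theorem cocycle_apply {𝔞 : Submodule F 𝔤} {s : 𝔤 →ₗ[F] 𝔊} (a b c : 𝔞) :
    cocycle BG 𝔞 s a b c = BG ⁅s a, s b⁆ (s c) := rfl

/-- A section of `π` together with a complement `𝔞` of `orthogonalIdeal` whose lift is isotropic
and orthogonal to the lift of `orthogonalIdeal`. -/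
structure IsIsotropicSection (h : IsIsotropicCentralExtension ι π BG) (𝔞 : Submodule F 𝔤)
    (s : 𝔤 →ₗ[F] 𝔊) : Prop where
  isCompl : IsCompl 𝔞 h.orthogonalIdeal.toSubmodule
  section_apply : ∀ p, π (s p) = p
  form_left : ∀ a b : 𝔞, BG (s a) (s b) = 0
  form_mixed : ∀ (a : 𝔞) (x : h.orthogonalIdeal), BG (s a) (s x) = 0

namespace IsIsotropicSection

variable {h : IsIsotropicCentralExtension ι π BG} {𝔞 : Submodule F 𝔤} {s : 𝔤 →ₗ[F] 𝔊}

/-- The component in `𝔞`. -/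
noncomputable def fst (H : h.IsIsotropicSection 𝔞 s) : 𝔤 →ₗ[F] 𝔞 :=
  𝔞.projectionOnto _ H.isCompl

/-- The component in `orthogonalIdeal`. -/
noncomputable def snd (H : h.IsIsotropicSection 𝔞 s) : 𝔤 →ₗ[F] h.orthogonalIdeal :=
  h.orthogonalIdeal.toSubmodule.projectionOnto 𝔞 H.isCompl.symm

theorem fst_add_snd (H : h.IsIsotropicSection 𝔞 s) (p : 𝔤) :
    (H.fst p : 𝔤) + (H.snd p : 𝔤) = p :=
  Submodule.projection_add_projection_eq_self H.isCompl p

theorem fst_left (H : h.IsIsotropicSection 𝔞 s) (a : 𝔞) : H.fst a = a :=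
  Submodule.projectionOnto_apply_left H.isCompl a

theorem fst_right (H : h.IsIsotropicSection 𝔞 s) (x : h.orthogonalIdeal) : H.fst x = 0 :=
  Submodule.projectionOnto_apply_right H.isCompl x

theorem snd_left (H : h.IsIsotropicSection 𝔞 s) (a : 𝔞) : H.snd a = 0 :=
  Submodule.projectionOnto_apply_right H.isCompl.symm a

theorem snd_right (H : h.IsIsotropicSection 𝔞 s) (x : h.orthogonalIdeal) : H.snd x = x :=
  Submodule.projectionOnto_apply_left H.isCompl.symm x

/-- `s x` is orthogonal to both `ι V` and `s 𝔞`, so only the ideal component of `π X` contributes.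
-/
theorem form_section_ideal (H : h.IsIsotropicSection 𝔞 s) (X : 𝔊) (x : h.orthogonalIdeal) :
    BG X (s x) = h.idealForm s (H.snd (π X)) x := by
  obtain ⟨v, hv⟩ := h.exists_eq_add (H.section_apply (π X)).symm
  have h1 : BG (ι v) (s x) = 0 :=
    h.apply_mem_orthogonalIdeal.1 (by simp [H.section_apply]) v
  rw [hv, map_add, LinearMap.add_apply, h1, add_zero]
  conv_lhs => rw [← H.fst_add_snd (π X)]
  simp [H.form_mixed, idealForm_apply, H.section_apply, h.exact.apply_apply_eq_zero]

theorem isInvariantMetric_idealForm (H : h.IsIsotropicSection 𝔞 s) :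
    IsInvariantMetric (h.idealForm s) := by
  refine .of_separating (fun x y => h.metric.symm _ _) (fun x hx => ?_) (fun x y z => ?_)
  · have h0 : s x = 0 := h.metric.eq_zero fun Y => by
      rw [h.metric.symm, H.form_section_ideal, idealForm_apply, h.metric.symm, ← idealForm_apply,
        hx]
    have := H.section_apply x
    rw [h0, map_zero] at this
    exact Subtype.ext this.symm
  · rw [h.idealForm_eq H.section_apply (H.section_apply x) (Y := ⁅s y, s z⁆),
      h.idealForm_eq H.section_apply (X := ⁅s x, s y⁆) _ (H.section_apply z), h.metric.invariant]
    all_goals simp [H.section_apply]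

/-- The data of the double central extension of `orthogonalIdeal` by `𝔞` isometric to `𝔊`. -/
def data (H : h.IsIsotropicSection 𝔞 s) :
    DoubleCentralData F 𝔞 H.isInvariantMetric_idealForm where
  φ := h.action ∘ₗ 𝔞.subtype
  Ψ := h.lieBracket.compl₁₂ 𝔞.subtype 𝔞.subtype
  ω := cocycle BG 𝔞 s
  phi_skew a x y := by
    rw [h.idealForm_eq H.section_apply (X := ⁅s a, s x⁆) _ (H.section_apply y),
      h.idealForm_eq H.section_apply (H.section_apply x) (Y := ⁅s a, s y⁆), h.metric.invariant,
      ← lie_skew (s a) (s x), map_neg, LinearMap.neg_apply]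
    all_goals simp [H.section_apply]
  psi_alt a := Subtype.ext (lie_self (a : 𝔤))
  phi_comm a b x := Subtype.ext (by
    change ⁅(a : 𝔤), ⁅(b : 𝔤), (x : 𝔤)⁆⁆ - ⁅(b : 𝔤), ⁅(a : 𝔤), (x : 𝔤)⁆⁆ =
      ⁅⁅(a : 𝔤), (b : 𝔤)⁆, (x : 𝔤)⁆
    rw [lie_lie])
  phi_cyclic a b c := Subtype.ext (lie_jacobi (a : 𝔤) (b : 𝔤) (c : 𝔤))
  chi_cyclic a b c d := by
    -- Each term becomes a pairing of `s d` with a double bracket of lifts, and the cyclic sum is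
    -- the Jacobi identity in `𝔊`.
    have key (a b c : 𝔞) : h.idealForm s (h.lieBracket a d) (h.lieBracket b c) =
        -BG (s d) ⁅s a, ⁅s b, s c⁆⁆ := by
      rw [h.idealForm_eq H.section_apply (X := ⁅s a, s d⁆) (Y := ⁅s b, s c⁆),
        h.metric.invariant (s d), ← lie_skew (s d) (s a), map_neg, LinearMap.neg_apply, neg_neg]
      all_goals simp [H.section_apply]
    have hj := congrArg (BG (s d)) (lie_jacobi (s a) (s b) (s c))
    simp only [map_add, map_zero] at hj
    have e1 := key a b c
    have e2 := key b c a
    have e3 := key c a b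
    simp only [LinearMap.compl₁₂_apply, Submodule.subtype_apply]
    linear_combination hj - e1 - e2 - e3
  omega_alt a := by ext c; simp
  omega_cyclic a b c := by
    simp only [cocycle_apply]
    rw [← h.metric.invariant, h.metric.symm]

theorem coe_data_φ (H : h.IsIsotropicSection 𝔞 s) (a : 𝔞) (x : h.orthogonalIdeal) :
    (H.data.φ a x : 𝔤) = ⁅(a : 𝔤), (x : 𝔤)⁆ := rfl

theorem coe_data_Ψ (H : h.IsIsotropicSection 𝔞 s) (a b : 𝔞) :
    (H.data.Ψ a b : 𝔤) = ⁅(a : 𝔤), (b : 𝔤)⁆ := rfl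

theorem data_ω_apply (H : h.IsIsotropicSection 𝔞 s) (a b c : 𝔞) :
    H.data.ω a b c = BG ⁅s a, s b⁆ (s c) := rfl

/-- `𝔞 ⊕ 𝔥 ≃ 𝔤`. -/
noncomputable def baseEquiv (H : h.IsIsotropicSection 𝔞 s) : H.data.Base ≃ₗ⁅F⁆ 𝔤 where
  toFun p := (p.a : 𝔤) + (p.x : 𝔤)
  map_add' p q := by
    simp only [DoubleCentralData.Base.a_add, DoubleCentralData.Base.x_add, Submodule.coe_add,
      LieSubmodule.coe_add]
    abel
  map_smul' t p := by simp
  map_lie' {p q} := by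
    have h1 := lie_skew (q.a : 𝔤) (p.x : 𝔤)
    simp only [DoubleCentralData.Base.a_lie, DoubleCentralData.Base.x_lie, LieSubmodule.coe_add,
      LieSubmodule.coe_sub, coe_data_φ, coe_data_Ψ, LieSubmodule.coe_bracket, LieIdeal.coe_bracket_of_module, add_lie, lie_add,
      ← h1, ZeroMemClass.coe_zero]
    abel
  invFun p := ⟨H.fst p, H.snd p⟩
  left_inv p := by
    ext1 <;> simp [H.fst_left, H.fst_right, H.snd_left, H.snd_right]
  right_inv p := H.fst_add_snd p

theorem baseEquiv_apply (H : h.IsIsotropicSection 𝔞 s) (p : H.data.Base) :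
    H.baseEquiv p = (p.a : 𝔤) + (p.x : 𝔤) := rfl

theorem baseEquiv_symm_apply (H : h.IsIsotropicSection 𝔞 s) (p : 𝔤) :
    H.baseEquiv.symm p = ⟨H.fst p, H.snd p⟩ := rfl

/-- This is the `𝔞*`-component of bracket compatibility for `totalHom`. Invariance moves `s c` into
the bracket, turning pairings with `s y`, for `y` in the ideal, into values of `idealForm`; the term
with both arguments in `𝔞` is `ω`. -/
theorem form_lie_section (H : h.IsIsotropicSection 𝔞 s) (p q : 𝔤) (c : 𝔞) :
    BG ⁅s p, s q⁆ (s c) = H.data.Phi (H.snd p) (H.snd q) c + H.data.chi (H.fst p) (H.snd q) c -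
      H.data.chi (H.fst q) (H.snd p) c + H.data.ω (H.fst p) (H.fst q) c := by
  have key (p : 𝔤) (y : h.orthogonalIdeal) :
      BG ⁅s p, s y⁆ (s c) = h.idealForm s (h.lieBracket c p) y := by
    rw [h.metric.symm, h.metric.invariant]
    symm
    exact h.idealForm_eq H.section_apply (by simp [H.section_apply]) (H.section_apply y)
  have e1 : H.data.Phi (H.snd p) (H.snd q) c = BG ⁅s (H.snd p), s (H.snd q)⁆ (s c) :=
    (key _ _).symm
  have e2 (a : 𝔞) (x : h.orthogonalIdeal) : H.data.chi a x c = BG ⁅s a, s x⁆ (s c) := by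
    rw [key, DoubleCentralData.chi_apply, H.data.psi_skew, map_neg, LinearMap.neg_apply, neg_neg]
    rfl
  rw [e1, e2, e2, data_ω_apply, ← lie_skew (s (H.fst q))]
  conv_lhs => rw [← H.fst_add_snd p, ← H.fst_add_snd q]
  simp only [map_add, map_neg, add_lie, lie_add, LinearMap.add_apply, LinearMap.neg_apply]
  ring

/-! ### The isometry onto the double central extension -/

variable [CharZero F]

/-- The isometry onto the double central extension, as a homomorphism. -/
noncomputable def totalHom (H : h.IsIsotropicSection 𝔞 s) : 𝔊 →ₗ⁅F⁆ H.data.Total where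
  toFun X := ⟨H.fst (π X), H.snd (π X), BG X ∘ₗ s ∘ₗ 𝔞.subtype⟩
  map_add' X Y := by
    ext1
    · simp
    · simp
    · ext; simp
  map_smul' t X := by
    ext1
    · simp
    · simp
    · ext; simp
  map_lie' {X Y} := by
    have h1 := H.baseEquiv.symm.map_lie (π X) (π Y)
    simp only [baseEquiv_symm_apply, ← LieHom.map_lie] at h1
    ext1
    · exact congrArg DoubleCentralData.Base.a h1
    · exact congrArg DoubleCentralData.Base.x h1
    · ext c
      change BG ⁅X, Y⁆ (s c) = _
      rw [h.lie_congr (H.section_apply (π X)).symm (H.section_apply (π Y)).symm]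
      exact H.form_lie_section (π X) (π Y) c

theorem totalHom_apply (H : h.IsIsotropicSection 𝔞 s) (X : 𝔊) :
    H.totalHom X = ⟨H.fst (π X), H.snd (π X), BG X ∘ₗ s ∘ₗ 𝔞.subtype⟩ := rfl

theorem totalHom_ι (H : h.IsIsotropicSection 𝔞 s) (v : V) :
    H.totalHom (ι v) = ⟨0, 0, pairing BG ι s 𝔞 v⟩ := by
  rw [totalHom_apply]
  ext1
  · simp [h.exact.apply_apply_eq_zero]
  · simp [h.exact.apply_apply_eq_zero]
  · rfl

theorem baseEquiv_proj_totalHom (H : h.IsIsotropicSection 𝔞 s) (X : 𝔊) :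
    H.baseEquiv (DoubleCentralData.Total.proj (H.totalHom X)) = π X :=
  H.fst_add_snd (π X)

theorem metric_totalHom (H : h.IsIsotropicSection 𝔞 s) (X Y : 𝔊) :
    DoubleCentralData.Total.metric (H.totalHom X) (H.totalHom Y) = BG X Y := by
  change h.idealForm s (H.snd (π X)) (H.snd (π Y)) + BG Y (s (H.fst (π X))) +
    BG X (s (H.fst (π Y))) = BG X Y
  -- The `V`-part `ι w` of `Y` carries the pairing of the `𝔞*`-coordinate of `Y` with the
  -- `𝔞`-coordinate of `X`.
  obtain ⟨w, hw⟩ := h.exists_eq_add (H.section_apply (π Y)).symm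
  have e (Z : 𝔊) (p : 𝔤) : BG Z (s p) =
      BG Z (s (H.fst p)) + h.idealForm s (H.snd (π Z)) (H.snd p) := by
    rw [← H.form_section_ideal, ← map_add, ← map_add, H.fst_add_snd]
  have e1 : BG X Y = BG X (s (π Y)) + BG X (ι w) := by rw [← map_add, ← hw]
  have e2 : BG X (ι w) = BG Y (s (H.fst (π X))) := by
    have e3 : BG (s (π Y)) (s (H.fst (π X))) = 0 := by
      rw [h.metric.symm, ← H.fst_add_snd (π Y), map_add, map_add, H.form_left, H.form_mixed,
        add_zero]
    have e4 : BG X (ι w) = BG (ι w) (s (π X)) := by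
      rw [h.metric.symm, h.form_congr w (H.section_apply (π X)).symm]
    have e5 : BG Y (s (π X)) = BG (s (π Y)) (s (π X)) + BG (ι w) (s (π X)) := by
      rw [← LinearMap.add_apply, ← map_add, ← hw]
    -- `Y` and `s (π Y)` have the same image in `𝔤`, so the `idealForm` terms on the two sides agree
    -- and cancel.
    rw [e Y, e (s (π Y)), H.section_apply, e3] at e5
    rw [e4]
    linear_combination -e5
  rw [e1, e2, e X (π Y)]
  ring

theorem totalHom_bijective [FiniteDimensional F 𝔤] [FiniteDimensional F V]
    (H : h.IsIsotropicSection 𝔞 s) : Function.Bijective H.totalHom := by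
  have hb := h.pairing_bijective H.section_apply H.isCompl
  constructor
  · refine (injective_iff_map_eq_zero _).2 fun X hX => ?_
    have hπ := H.baseEquiv_proj_totalHom X
    rw [hX, map_zero, map_zero] at hπ
    obtain ⟨v, rfl⟩ := (h.exact X).1 hπ.symm
    rw [H.totalHom_ι] at hX
    have hv : pairing BG ι s 𝔞 v = 0 := congrArg DoubleCentralData.Total.α hX
    rw [(injective_iff_map_eq_zero _).1 hb.1 v hv, map_zero]
  · rintro ⟨a, x, α⟩
    -- The lift `s (a + x)` has the right `𝔞` and ideal coordinates; `ι v` repairs the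
    -- `𝔞*`-coordinate without touching them.
    obtain ⟨v, hv⟩ := hb.2 (α - BG (s (a + x)) ∘ₗ s ∘ₗ 𝔞.subtype)
    refine ⟨s (a + x) + ι v, ?_⟩
    rw [map_add, H.totalHom_ι, totalHom_apply, hv]
    ext1
    · simp [H.section_apply, H.fst_left, H.fst_right]
    · simp [H.section_apply, H.snd_left, H.snd_right]
    · simp

end IsIsotropicSection

end IsIsotropicCentralExtension

/-! ### The two cases of the theorem -/

theorem mainTheorem1 {F 𝔤 V 𝔊 : Type*} [Field F] [IsAlgClosed F] [CharZero F]
    [LieRing 𝔤] [LieAlgebra F 𝔤] [FiniteDimensional F 𝔤]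
    [LieRing V] [LieAlgebra F V] [IsLieAbelian V] [FiniteDimensional F V]
    [LieRing 𝔊] [LieAlgebra F 𝔊]
    (n r : ℕ) (hn : finrank F 𝔤 = n) (hr : finrank F V = r)
    (Bg : LinearMap.BilinForm F 𝔤) (hBg : IsInvariantMetric Bg)
    (ι : V →ₗ⁅F⁆ 𝔊) (π : 𝔊 →ₗ⁅F⁆ 𝔤) (hext : LieAlgebra.IsExtension ι π)
    (hcentral : ∀ v, ι v ∈ LieAlgebra.center F 𝔊)
    (BG : LinearMap.BilinForm F 𝔊) (hBG : IsInvariantMetric BG) :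
    -- `V` non-degenerate
    ((BG.comp (ι : V →ₗ[F] 𝔊) (ι : V →ₗ[F] 𝔊)).Nondegenerate →
      ∃ Bg' : LinearMap.BilinForm F 𝔤, IsInvariantMetric Bg' ∧
        ∃ ψ : 𝔊 ≃ₗ⁅F⁆ 𝔤 × V, ∀ X Y : 𝔊,
          BG X Y = Bg' (ψ X).1 (ψ Y).1 + BG (ι (ψ X).2) (ι (ψ Y).2)) ∧
    -- `V` isotropic
    ((∀ u v : V, BG (ι u) (ι v) = 0) →
      r ≤ finrank F (LieAlgebra.center F 𝔤) ∧
      ∃ (𝔞 : Submodule F 𝔤) (𝔥 : LieIdeal F 𝔤),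
        IsCompl 𝔞 𝔥.toSubmodule ∧ finrank F 𝔞 = r ∧ finrank F 𝔥 + r = n ∧
        (∀ x y : 𝔤, ⁅x, y⁆ ∈ 𝔥) ∧
        ∃ (Bh : LinearMap.BilinForm F 𝔥) (hBh : IsInvariantMetric Bh)
          (D : DoubleCentralData F 𝔞 hBh)
          (Ω : 𝔊 ≃ₗ⁅F⁆ D.Total) (ξ : V ≃ₗ[F] Dual F 𝔞)
          (e : D.Base ≃ₗ⁅F⁆ 𝔤) (Bah : LinearMap.BilinForm F D.Base),
          -- `𝔊` is isometric to the double central extension `𝔞 ⊕ 𝔥 ⊕ 𝔞*`, and `V ≅ 𝔞*`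
          (∀ X Y, BG X Y = DoubleCentralData.Total.metric (Ω X) (Ω Y)) ∧
          (∀ v, Ω (ι v) = ⟨0, 0, ξ v⟩) ∧
          -- `𝔤 = 𝔞 ⊕ 𝔥` as quadratic Lie algebras, compatibly with the projections
          IsInvariantMetric Bah ∧
          (∀ p, e p = (p.a : 𝔤) + (p.x : 𝔤)) ∧
          (∀ p q, Bah p q = Bg (e p) (e q)) ∧
          (∀ X, e (DoubleCentralData.Total.proj (Ω X)) = π X)) := by
  have hinj : Function.Injective ι := ι.ker_eq_bot.1 hext.ker_eq_bot
  have hsurj : Function.Surjective π := π.range_eq_top.1 hext.range_eq_top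
  have hexact : Function.Exact ι π := (ι.range_eq_ker_iff π).1 hext.exact
  have hc (v : V) (X : 𝔊) : ⁅ι v, X⁆ = 0 := by
    rw [← lie_skew, (LieModule.mem_maxTrivSubmodule F 𝔊 𝔊 (ι v)).1 (hcentral v) X, neg_zero]
  refine ⟨exists_isometry_prod_of_nondegenerate hsurj hexact hc hBG, fun hiso => ?_⟩
  have h : IsIsotropicCentralExtension (ι : V →ₗ[F] 𝔊) π BG :=
    ⟨hBG, hinj, hsurj, hexact, hc, hiso⟩
  obtain ⟨𝔞, h𝔞⟩ := h.orthogonalIdeal.toSubmodule.exists_isCompl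
  obtain ⟨s, hs, hform⟩ := h.exists_isotropic_section h𝔞.symm
  have H : h.IsIsotropicSection 𝔞 s :=
    ⟨h𝔞.symm, hs, fun a b => (hform a a.2).1 b b.2, fun a x => (hform a a.2).2 x x.2⟩
  have h1 : finrank F h.orthogonalIdeal.toSubmodule + finrank F V = finrank F 𝔤 :=
    h.finrank_orthogonalIdeal
  have h2 := Submodule.finrank_add_eq_of_isCompl h𝔞
  refine ⟨hr ▸ h.finrank_le_finrank_center hBg, 𝔞, h.orthogonalIdeal, h𝔞.symm, by omega,
    by rw [← hn, ← hr]; exact h1, h.lie_mem_orthogonalIdeal, h.idealForm s,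
    H.isInvariantMetric_idealForm, H.data, LieEquiv.ofBijective H.totalHom H.totalHom_bijective,
    LinearEquiv.ofBijective _ (h.pairing_bijective hs h𝔞.symm), H.baseEquiv, _,
    fun X Y => (H.metric_totalHom X Y).symm, H.totalHom_ι, hBg.comp_equiv H.baseEquiv,
    fun _ => rfl, fun _ _ => rfl, H.baseEquiv_proj_totalHom⟩
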